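/- Let $p$ be a prime number, let $k\ge 1$ be an integer, and let $\mathbf F_{p^k}$ be a field with $p^k$ elements. Let $\mathrm{PGL}_2(\mathbf F_{p^k})$ and $\mathrm{PSL}_2(\mathbf F_{p^k})$ be the quotients of $\mathrm{GL}_2(\mathbf F_{p^k})$ and $\mathrm{SL}_2(\mathbf F_{p^k})$ by their centers, and regard $\mathrm{PSL}_2(\mathbf F_{p^k})$ as a subgroup of $\mathrm{PGL}_2(\mathbf F_{p^k})$ through the natural inclusion. Let $T=\mathrm{Aut}(\mathbf F_{p^k})$ be the group of field automorphisms, acting on $\mathrm{PGL}_2(\mathbf F_{p^k})$ and $\mathrm{PSL}_2(\mathbf F_{p^k})$ through the entries of matrices. Then $T$ is cyclic of order $k$, generated by the Frobenius automorphism $a\mapsto a^p$, and there are group isomorphisms $$\mathrm{Aut}(\mathrm{PSL}_2(\mathbf F_{p^k}))\cong \mathrm{Aut}(\mathrm{PGL}_2(\mathbf F_{p^k}))\cong \mathrm{PGL}_2(\mathbf F_{p^k})\rtimes T,$$ where the semidirect product is formed with respect to the above action of $T$ on $\mathrm{PGL}_2(\mathbf F_{p^k})$. More precisely, the isomorphisms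 of $\mathrm{PGL}_2(\mathbf F_{p^k})\rtimes T$ with the two automorphism groups can be chosen so that $(g,\sigma)$ corresponds to the automorphism $h\mapsto g\,\sigma(h)\,g^{-1}$ of $\mathrm{PSL}_2(\mathbf F_{p^k})$, respectively of $\mathrm{PGL}_2(\mathbf F_{p^k})$ (so $\mathrm{PGL}_2(\mathbf F_{p^k})$ acts by conjugation and $T$ through the entries of matrices), and the isomorphism between the two automorphism groups can be chosen so that it sends each automorphism of $\mathrm{PSL}_2(\mathbf F_{p^k})$ to an extension of it to $\mathrm{PGL}_2(\mathbf F_{p^k})$. -/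

import Mathlib

open scoped MatrixGroups

/-- The homomorphism `PGL₂(F) → PGL₂(F)` induced by applying a ring endomorphism `f` of `F` to the
entries of a matrix: the class of `(a i j)` is sent to the class of `(f (a i j))`. -/
def pglMap {F : Type*} [Field F] (f : F →+* F) :
    Matrix.ProjGenLinGroup (Fin 2) F →* Matrix.ProjGenLinGroup (Fin 2) F :=
  Matrix.ProjGenLinGroup.lift
    (Matrix.ProjGenLinGroup.mk.comp (Matrix.GeneralLinearGroup.map f)) (by
      ext u
      simp [Matrix.GeneralLinearGroup.map_scalar])

theorem pglMap_mk {F : Type*} [Field F] (f : F →+* F) (g : GL (Fin 2) F) :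
    pglMap f (Matrix.ProjGenLinGroup.mk g) =
      Matrix.ProjGenLinGroup.mk (Matrix.GeneralLinearGroup.map f g) := rfl

theorem pglMap_id {F : Type*} [Field F] (x : Matrix.ProjGenLinGroup (Fin 2) F) :
    pglMap (RingHom.id F) x = x := by
  induction x using Matrix.ProjGenLinGroup.induction_on with
  | mk g => rw [pglMap_mk, Matrix.GeneralLinearGroup.map_id]; rfl

theorem pglMap_comp {F : Type*} [Field F] (f g : F →+* F)
    (x : Matrix.ProjGenLinGroup (Fin 2) F) :
    pglMap (f.comp g) x = pglMap f (pglMap g x) := by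
  induction x using Matrix.ProjGenLinGroup.induction_on with
  | mk a => rfl

/-- The action of the group of field automorphisms of `F` on `PGL₂(F)`, through the entries of
matrices. -/
def fieldAutAction (F : Type*) [Field F] :
    RingAut F →* MulAut (Matrix.ProjGenLinGroup (Fin 2) F) where
  toFun σ :=
    { toFun := pglMap (σ : F →+* F)
      invFun := pglMap ((σ⁻¹ : RingAut F) : F →+* F)
      left_inv := fun x => by
        rw [← pglMap_comp]
        have h : ((σ⁻¹ : RingAut F) : F →+* F).comp (σ : F →+* F) = RingHom.id F :=
          RingHom.ext fun a => σ.symm_apply_apply a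
        rw [h, pglMap_id]
      right_inv := fun x => by
        rw [← pglMap_comp]
        have h : (σ : F →+* F).comp ((σ⁻¹ : RingAut F) : F →+* F) = RingHom.id F :=
          RingHom.ext fun a => σ.apply_symm_apply a
        rw [h, pglMap_id]
      map_mul' := fun x y => map_mul _ x y }
  map_one' := MulEquiv.ext fun x => pglMap_id x
  map_mul' σ τ := MulEquiv.ext fun x => pglMap_comp (σ : F →+* F) (τ : F →+* F) x

/-! Let `φ : SL₂(F) → PGL₂(F)` be induced by an automorphism of `PSL₂(F)` or of `PGL₂(F)`. The image
of `upperUnip 1` has order `p`, hence is conjugate to the class of `upperUnip 1`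
(`exists_conj_eq_upperUnip`), and that class is centralized only by upper unipotents. So after
conjugation `φ` acts on upper unipotents through an additive `f` with `f 1 = 1`. A further
conjugation, by an upper unipotent, makes lower unipotents go to lower ones.

Conjugation by `weylElt a` turns the entry `c` into `-(c / a ^ 2)`, which forces `f (c * a ^ 2) = f
c * f a ^ 2` (`unip_relation`). Every element of a finite field is a sum of two squares, so `f` is a
ring endomorphism, and unipotents generate `SL₂(F)`: thus `φ` is a field automorphism followed by a
conjugation (`exists_conj_pglMap`).

The pair is unique because the centralizers of the upper and lower unipotents with entry `1` meet
trivially. An automorphism of `PGL₂(F)` is determined by its restriction to `PSL₂(F)`, whose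
centralizer is trivial. -/

open Matrix

/-! ### Unipotent generators of `SL₂` and the Weyl relation. -/

section Unipotent

variable {F : Type*} [Field F]

/-- The upper unitriangular matrix with entry `c`. -/
def upperUnip (c : F) : SL(2, F) := ⟨!![1, c; 0, 1], by simp⟩

/-- The lower unitriangular matrix with entry `c`. -/
def lowerUnip (c : F) : SL(2, F) := ⟨!![1, 0; c, 1], by simp⟩

/-- The antidiagonal matrix `!![0, a; -a⁻¹, 0]`, as a product of unitriangular matrices. -/
def weylElt (a : F) : SL(2, F) := upperUnip a * lowerUnip (-a⁻¹) * upperUnip a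

@[simp]
theorem coe_upperUnip (c : F) :
    (upperUnip c : Matrix (Fin 2) (Fin 2) F) = !![1, c; 0, 1] := rfl

@[simp]
theorem coe_lowerUnip (c : F) :
    (lowerUnip c : Matrix (Fin 2) (Fin 2) F) = !![1, 0; c, 1] := rfl

theorem upperUnip_add (a b : F) : upperUnip (a + b) = upperUnip a * upperUnip b := by
  ext i j; fin_cases i <;> fin_cases j <;> simp [Matrix.mul_apply, add_comm]

theorem upperUnip_zero : upperUnip (0 : F) = 1 := by
  ext i j; fin_cases i <;> fin_cases j <;> simp

theorem lowerUnip_zero : lowerUnip (0 : F) = 1 := by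
  ext i j; fin_cases i <;> fin_cases j <;> simp

theorem upperUnip_pow (c : F) (n : ℕ) : upperUnip c ^ n = upperUnip (n * c) := by
  induction n with
  | zero => simp [upperUnip_zero]
  | succ n ih => rw [pow_succ, ih, ← upperUnip_add]; congr 1; push_cast; ring

theorem coe_weylElt {a : F} (ha : a ≠ 0) :
    (weylElt a : Matrix (Fin 2) (Fin 2) F) = !![0, a; -a⁻¹, 0] := by
  ext i j; fin_cases i <;> fin_cases j <;>
    simp [weylElt, Matrix.mul_apply, ha]

/-- The square of `a` appearing here is the source of the multiplicativity of `f`. -/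
theorem weylElt_mul_upperUnip {a : F} (ha : a ≠ 0) (c : F) :
    weylElt a * upperUnip c = lowerUnip (-(c / a ^ 2)) * weylElt a := by
  ext i j; fin_cases i <;> fin_cases j <;> simp [coe_weylElt ha]
  field_simp

/-- The special linear group of degree two is generated by unitriangular matrices. -/
theorem monoidHom_ext_unip {G : Type*} [Group G] {φ ψ : SL(2, F) →* G}
    (hu : ∀ c, φ (upperUnip c) = ψ (upperUnip c))
    (hl : ∀ c, φ (lowerUnip c) = ψ (lowerUnip c)) : φ = ψ := by
  have key : ∀ h : SL(2, F), h 1 0 ≠ 0 → φ h = ψ h := by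
    intro h hc
    have hdet := h.det_coe
    rw [Matrix.det_fin_two] at hdet
    have : h = upperUnip ((h 0 0 - 1) / h 1 0) * lowerUnip (h 1 0) *
        upperUnip ((h 1 1 - 1) / h 1 0) := by
      ext i j; fin_cases i <;> fin_cases j <;> simp [hc]
      · field_simp
        linear_combination -hdet
      · field_simp
        ring
    rw [this]
    simp only [map_mul, hu, hl]
  ext1 h
  by_cases hc : h 1 0 = 0
  · have hdet := h.det_coe
    rw [Matrix.det_fin_two, hc, mul_zero, sub_zero] at hdet
    -- The lower left entry of this product is `h 1 1`, nonzero since `h 0 0 * h 1 1 = 1`.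
    have h1 := key (h * lowerUnip 1) (by
      simpa [Matrix.mul_apply, hc] using right_ne_zero_of_mul_eq_one hdet)
    simpa only [map_mul, hl, mul_left_inj] using h1
  · exact key h hc

end Unipotent

/-! ### Centralizers of unipotents and elements of order `p` in `PGL₂`. -/

section ProjGen

variable {F : Type*} [Field F]

open Matrix.SpecialLinearGroup

theorem exists_entries_of_mk_eq {g h : GL (Fin 2) F}
    (e : ProjGenLinGroup.mk g = ProjGenLinGroup.mk h) :
    ∃ l : F, l ≠ 0 ∧ ∀ i j, h i j = l * g i j := by
  obtain ⟨u, rfl⟩ := ProjGenLinGroup.mk_eq_mk_iff.1 e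
  refine ⟨u, u.ne_zero, fun i j => ?_⟩
  simp [mul_comm]

theorem mk_eq_of_entries {g h : GL (Fin 2) F} {l : F} (hl : l ≠ 0)
    (e : ∀ i j, h i j = l * g i j) : ProjGenLinGroup.mk g = ProjGenLinGroup.mk h := by
  refine ProjGenLinGroup.mk_eq_mk_iff.2 ⟨Units.mk0 l hl, ?_⟩
  ext i j
  simp [e, mul_comm]

theorem GL_det_ne_zero (g : GL (Fin 2) F) : g 0 0 * g 1 1 - g 0 1 * g 1 0 ≠ 0 := by
  rw [← Matrix.det_fin_two]
  exact g.det_ne_zero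

theorem toPGL_upperUnip_injective :
    Function.Injective fun c : F => toPGL (upperUnip c) := by
  intro a b e
  obtain ⟨l, hl, h⟩ := exists_entries_of_mk_eq (g := toGL (upperUnip a)) (h := toGL (upperUnip b)) e
  have h0 := h 0 0
  have h1 := h 0 1
  simp at h0 h1
  simpa [← h0] using h1.symm

/-- The class of the upper unitriangular matrix with entry one has centralizer the group of
classes of upper unitriangular matrices. -/
theorem exists_eq_upperUnip_of_commute {x : PGL(2, F)} (hx : Commute x (toPGL (upperUnip 1))) :
    ∃ c, x = toPGL (upperUnip c) := by
  induction x using ProjGenLinGroup.induction_on with | mk g =>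
  obtain ⟨l, hl, h⟩ := exists_entries_of_mk_eq (g := g * toGL (upperUnip 1))
    (h := toGL (upperUnip 1) * g) hx
  have hd := GL_det_ne_zero g
  have h00 := h 0 0
  have h01 := h 0 1
  have h10 := h 1 0
  have h11 := h 1 1
  simp [Matrix.mul_apply] at h00 h01 h10 h11
  -- A nonzero `g 1 0` forces `l = 1` in the lower left entry; the upper left entries then give `g 1
  -- 0 = 0`.
  have z : g 1 0 = 0 := by
    by_contra hz
    have : l = 1 := by
      apply mul_right_cancel₀ hz; linear_combination -h10
    subst this
    exact hz (by linear_combination h00)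
  rw [z] at h00 h11 hd
  have hx : g 0 0 ≠ 0 := by rintro h; simp [h] at hd
  have : l = 1 := by
    apply mul_right_cancel₀ hx; linear_combination -h00
  subst this
  refine ⟨g 0 1 / g 0 0, (mk_eq_of_entries hx ?_).symm⟩
  intro i j
  fin_cases i <;> fin_cases j <;> simp [z]
  · field_simp
  · linear_combination h01

/-- Conjugation by `weylElt 1` carries the inverse of `upperUnip 1` to `lowerUnip 1`, which reduces
this to the upper case. -/
theorem exists_eq_lowerUnip_of_commute {x : PGL(2, F)} (hx : Commute x (toPGL (lowerUnip 1))) :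
    ∃ c, x = toPGL (lowerUnip c) := by
  have e : toPGL (weylElt (1 : F)) * toPGL (upperUnip (-1)) =
      toPGL (lowerUnip 1) * toPGL (weylElt (1 : F)) := by
    rw [← map_mul, weylElt_mul_upperUnip one_ne_zero, map_mul]; simp
  have hm : upperUnip (-1 : F) = (upperUnip 1)⁻¹ := by
    rw [eq_inv_iff_mul_eq_one, ← upperUnip_add]; simp [upperUnip_zero]
  set w := toPGL (weylElt (1 : F)) with hw
  have e' : toPGL (lowerUnip (1 : F)) = w * (toPGL (upperUnip 1))⁻¹ * w⁻¹ := by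
    rw [eq_mul_inv_iff_mul_eq, ← e, hm, map_inv]
  have hc : Commute (w⁻¹ * x * w) (toPGL (upperUnip 1)) := by
    have h3 : Commute (w⁻¹ * x * w) (toPGL (upperUnip 1))⁻¹ := by
      have := (Commute.conj_iff w⁻¹).2 hx
      rw [e'] at this
      convert this using 1 <;> group
    simpa using h3.inv_right
  obtain ⟨c, hc⟩ := exists_eq_upperUnip_of_commute hc
  refine ⟨-c, ?_⟩
  have h2 : w * toPGL (upperUnip c) = toPGL (lowerUnip (-c)) * w := by
    rw [hw, ← map_mul, weylElt_mul_upperUnip one_ne_zero, map_mul]; simp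
  rw [← hc] at h2
  have : x * w = toPGL (lowerUnip (-c)) * w := by rw [← h2]; group
  exact mul_right_cancel this

/-- An element of order `p` is conjugate to the class of a unitriangular matrix. -/
theorem exists_conj_eq_upperUnip [Finite F] (p : ℕ) [Fact p.Prime] [CharP F p] {x : PGL(2, F)}
    (hx : x ^ p = 1) (hx1 : x ≠ 1) : ∃ y : PGL(2, F), x * y = y * toPGL (upperUnip 1) := by
  induction x using ProjGenLinGroup.induction_on with | mk g =>
  rw [← map_pow] at hx
  obtain ⟨l, hl, h⟩ := exists_entries_of_mk_eq (g := 1) (h := g ^ p) hx.symm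
  -- With `l = d ^ p`, the difference `N` of `g` and the scalar `d` satisfies `N ^ p = g ^ p - d ^ p
  -- = 0`.
  obtain ⟨d, hd⟩ := surjective_frobenius F p l
  rw [frobenius_def] at hd
  have hd0 : d ≠ 0 := by
    rintro rfl
    rw [zero_pow (Fact.out : p.Prime).ne_zero] at hd
    exact hl hd.symm
  set N : Matrix (Fin 2) (Fin 2) F := (g : Matrix (Fin 2) (Fin 2) F) - Matrix.scalar (Fin 2) d
    with hN
  have hNp : N ^ p = 0 := by
    rw [hN, sub_pow_char_of_commute]
    · rw [← map_pow, hd, sub_eq_zero]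
      ext i j
      have := h i j
      simpa [Matrix.one_apply, Matrix.diagonal_apply] using this
    · exact (Matrix.scalar_commute d (fun _ => Commute.all _ _) _).symm
  have hnil : IsNilpotent N := ⟨p, hNp⟩
  have htr : N.trace = 0 := (Matrix.isNilpotent_trace_of_isNilpotent hnil).eq_zero
  have hdet : N.det = 0 := by
    have h0 := congrArg Matrix.det hNp
    rw [Matrix.det_pow, Matrix.det_zero] at h0
    exact eq_zero_of_pow_eq_zero h0
  rw [Matrix.trace_fin_two] at htr
  rw [Matrix.det_fin_two] at hdet
  have h00 : N 0 0 = g 0 0 - d := by simp [hN]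
  have h01 : N 0 1 = g 0 1 := by simp [hN]
  have h10 : N 1 0 = g 1 0 := by simp [hN]
  have h11 : N 1 1 = g 1 1 - d := by simp [hN]
  rw [h00, h11] at htr
  rw [h00, h01, h10, h11] at hdet
  -- The conjugating matrix has columns `N e / d` and `e`, for a standard basis vector `e` with `N e
  -- ≠ 0`. As `N ^ 2 = 0`, in this basis `g` is `d` times `upperUnip 1`. If both columns of `N`
  -- vanish, `g` is scalar.
  by_cases hb : g 0 1 = 0
  · have this : g 0 0 - d = 0 := by
      apply pow_eq_zero_iff (two_ne_zero) |>.1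
      rw [hb] at hdet
      linear_combination (g 0 0 - d) * htr - hdet
    by_cases hc : g 1 0 = 0
    · exfalso
      apply hx1
      have h1 : ProjGenLinGroup.mk (1 : GL (Fin 2) F) = ProjGenLinGroup.mk g := by
        refine mk_eq_of_entries hd0 ?_
        intro i j
        fin_cases i <;> fin_cases j <;> simp [hb, hc]
        · linear_combination this
        · linear_combination htr - this
      rw [← h1, map_one]
    · refine ⟨ProjGenLinGroup.mk (GeneralLinearGroup.mkOfDetNeZero
        !![(g 0 0 - d) / d, 1; g 1 0 / d, 0] (by simp [hd0, hc])), ?_⟩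
      rw [← map_mul]
      refine (mk_eq_of_entries (g := _ * toGL (upperUnip 1)) hd0 ?_).symm
      intro i j
      fin_cases i <;> fin_cases j <;>
        simp [Matrix.mul_apply, GeneralLinearGroup.mkOfDetNeZero, hb]
      · field_simp
        exact Or.inl (sub_eq_zero.1 this)
      · field_simp
        ring
      · field_simp
        linear_combination htr
      · field_simp
  · refine ⟨ProjGenLinGroup.mk (GeneralLinearGroup.mkOfDetNeZero
        !![g 0 1 / d, 0; (g 1 1 - d) / d, 1] (by simp [hd0, hb])), ?_⟩
    rw [← map_mul]
    refine (mk_eq_of_entries (g := _ * toGL (upperUnip 1)) hd0 ?_).symm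
    intro i j
    fin_cases i <;> fin_cases j <;>
      simp [Matrix.mul_apply, GeneralLinearGroup.mkOfDetNeZero]
    · field_simp
      linear_combination htr
    · field_simp
    · field_simp
      linear_combination (g 1 1 - d) * htr - hdet
    · field_simp
      ring

end ProjGen

/-! ### Homomorphisms from `SL₂` to `PGL₂`. -/

section Hom

variable {F : Type*} [Field F]

open Matrix.SpecialLinearGroup

/-- The ring endomorphism underlying an additive map compatible with multiplication by squares. -/
def ringHomOfSquares (f : F → F) (hadd : ∀ a b, f (a + b) = f a + f b) (hone : f 1 = 1)
    (hsq : ∀ a c, f (c * a ^ 2) = f c * f a ^ 2) (hgen : ∀ x : F, ∃ a b, x = a ^ 2 + b ^ 2) :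
    F →+* F where
  toFun := f
  map_one' := hone
  map_zero' := by simpa using hadd 0 0
  map_add' := hadd
  map_mul' x y := by
    obtain ⟨a, b, rfl⟩ := hgen y
    have h1 := hsq a 1
    have h2 := hsq b 1
    rw [one_mul, hone, one_mul] at h1 h2
    rw [mul_add, hadd, hadd, hsq, hsq, h1, h2, mul_add]

theorem exists_sq_add_sq [Finite F] (x : F) : ∃ a b, x = a ^ 2 + b ^ 2 := by
  have := Fintype.ofFinite F
  by_cases h2 : ringChar F = 2
  · obtain ⟨a, ha⟩ := FiniteField.isSquare_of_char_two h2 x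
    exact ⟨a, 0, by rw [ha]; ring⟩
  · obtain ⟨a, b, h⟩ := FiniteField.exists_root_sum_quadratic (f := .X ^ 2) (g := .X ^ 2 - .C x)
      (Polynomial.degree_X_pow 2) (Polynomial.degree_X_pow_sub_C two_pos x)
      (FiniteField.odd_card_of_char_ne_two h2)
    refine ⟨a, b, ?_⟩
    simp at h
    linear_combination -h

theorem map_lowerUnip {G : Type*} [Group G] (φ : SL(2, F) →* G) (s : F) :
    φ (lowerUnip s) = φ (weylElt 1) * φ (upperUnip (-s)) * (φ (weylElt 1))⁻¹ := by
  rw [eq_mul_inv_iff_mul_eq, ← map_mul, ← map_mul, weylElt_mul_upperUnip one_ne_zero]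
  simp

/-- Such a `g` moves the line fixed by the upper unipotents to the line fixed by the lower ones. -/
theorem conj_upperUnip_of_apply_zero {g : GL (Fin 2) F} (hg : g 0 0 = 0) :
    ∃ r : F, ∀ c, ProjGenLinGroup.mk g * toPGL (upperUnip c) * (ProjGenLinGroup.mk g)⁻¹ =
      toPGL (lowerUnip (r * c)) := by
  have hd := GL_det_ne_zero g
  rw [hg, zero_mul, zero_sub, neg_ne_zero] at hd
  refine ⟨g 1 0 / g 0 1, fun c => ?_⟩
  rw [mul_inv_eq_iff_eq_mul]
  refine mk_eq_of_entries (g := g * toGL (upperUnip c)) (h := toGL (lowerUnip _) * g)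
    one_ne_zero ?_
  have := left_ne_zero_of_mul hd
  intro i j
  fin_cases i <;> fin_cases j <;> simp [Matrix.mul_apply, hg]
  field_simp

/-- Conjugation of unitriangular matrices by an antidiagonal one constrains a homomorphism from
`SL₂` that maps upper and lower unitriangular matrices to such through proportional functions. -/
theorem unip_relation {φ : SL(2, F) →* PGL(2, F)} {f : F → F} {r : F} (hone : f 1 = 1)
    (hinj : ∀ a, a ≠ 0 → f a ≠ 0)
    (hneg : ∀ a, f (-a) = - f a)
    (hu : ∀ c, φ (upperUnip c) = toPGL (upperUnip (f c)))
    (hl : ∀ c, φ (lowerUnip c) = toPGL (lowerUnip (r * f c))) {a : F} (ha : a ≠ 0) (c : F) :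
    r * f (c / a ^ 2) = f c / f a ^ 2 := by
  have hA := hinj a ha
  set A := f a with hAdef
  set b := r * f (-a⁻¹) with hb
  have key : ∀ c, ∃ l : F, l ≠ 0 ∧ ∀ i j,
      (!![1, 0; r * f (-(c / a ^ 2)), 1] * (!![1, A; 0, 1] * !![1, 0; b, 1] * !![1, A; 0, 1]) :
        Matrix (Fin 2) (Fin 2) F) i j =
      l * ((!![1, A; 0, 1] * !![1, 0; b, 1] * !![1, A; 0, 1]) * !![1, f c; 0, 1] :
        Matrix (Fin 2) (Fin 2) F) i j := by
    intro c
    have h := congrArg φ (weylElt_mul_upperUnip ha c)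
    simp only [weylElt, map_mul, hu, hl] at h
    simp only [← map_mul] at h
    obtain ⟨l, hl, h'⟩ := exists_entries_of_mk_eq h
    exact ⟨l, hl, fun i j => by simpa using h' i j⟩
  -- Both diagonal entries of the image of `weylElt a` equal `1 + A * b`. If this were nonzero, the
  -- top rows at `c = 1` would give `l = 1` and then `1 + A * b = 0`.
  have hm : 1 + A * b = 0 := by
    obtain ⟨l, hl, h⟩ := key 1
    have h00 := h 0 0
    have h01 := h 0 1
    simp [hone] at h00 h01
    by_contra hne
    have : l = 1 := by
      apply mul_right_cancel₀ hne; linear_combination -h00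
    subst this
    exact hne (by linear_combination -h01)
  obtain ⟨l, hl, h⟩ := key c
  have h01 := h 0 1
  have h11 := h 1 1
  simp at h01 h11
  have hl1 : l = 1 := by
    apply mul_right_cancel₀ hA
    linear_combination -h01 + (A * (1 - l) - l * f c) * hm
  subst hl1
  rw [hneg] at h11
  clear_value b
  rw [eq_div_iff (pow_ne_zero 2 hA)]
  linear_combination (-A) * h11 - (r * f (c / a ^ 2) * A ^ 2 + f c) * hm

theorem conj_upperUnip_of_apply_one_zero {g : GL (Fin 2) F} (hg : g 1 0 = 0) (c : F) :
    ∃ d, ProjGenLinGroup.mk g * toPGL (upperUnip c) * (ProjGenLinGroup.mk g)⁻¹ =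
      toPGL (upperUnip d) := by
  have hd := GL_det_ne_zero g
  rw [hg, mul_zero, sub_zero] at hd
  refine ⟨g 0 0 / g 1 1 * c, ?_⟩
  rw [mul_inv_eq_iff_eq_mul]
  refine mk_eq_of_entries (g := g * toGL (upperUnip c)) (h := toGL (upperUnip _) * g)
    one_ne_zero ?_
  have := right_ne_zero_of_mul hd
  intro i j
  fin_cases i <;> fin_cases j <;> simp [Matrix.mul_apply, hg]
  field_simp
  ring

theorem pglMap_toPGL (σ : F →+* F) (h : SL(2, F)) :
    pglMap σ (toPGL h) = toPGL (SpecialLinearGroup.map σ h) := by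
  refine mk_eq_of_entries (l := 1) one_ne_zero ?_
  intro i j
  simp

theorem map_upperUnip (σ : F →+* F) (c : F) :
    SpecialLinearGroup.map σ (upperUnip c) = upperUnip (σ c) := by
  ext i j; fin_cases i <;> fin_cases j <;> simp

theorem map_ring_lowerUnip (σ : F →+* F) (c : F) :
    SpecialLinearGroup.map σ (lowerUnip c) = lowerUnip (σ c) := by
  ext i j; fin_cases i <;> fin_cases j <;> simp

/-- A homomorphism `SL₂ → PGL₂` that preserves upper unitriangular matrices, fixes the one with
entry `1`, and sends the Weyl element to a matrix with vanishing top left entry is induced by a ring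
endomorphism. -/
theorem exists_ringHom_of_normalized [Finite F] {φ : SL(2, F) →* PGL(2, F)} {f : F → F}
    (hu : ∀ c, φ (upperUnip c) = toPGL (upperUnip (f c))) (hone : f 1 = 1)
    (hne : ∀ c, c ≠ 0 → f c ≠ 0)
    {g : GL (Fin 2) F} (hw : φ (weylElt 1) = ProjGenLinGroup.mk g) (hg : g 0 0 = 0) :
    ∃ σ : F →+* F, ∀ h, φ h = pglMap σ (toPGL h) := by
  have hadd : ∀ a b, f (a + b) = f a + f b := by
    intro a b
    apply toPGL_upperUnip_injective
    change toPGL _ = toPGL _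
    rw [← hu, upperUnip_add, map_mul, hu, hu, upperUnip_add, map_mul]
  have hneg : ∀ a, f (-a) = - f a := by
    have h0 : f 0 = 0 := by simpa using hadd 0 0
    intro a
    rw [eq_neg_iff_add_eq_zero, ← hadd, neg_add_cancel, h0]
  obtain ⟨r, hr⟩ := conj_upperUnip_of_apply_zero hg
  have hl : ∀ c, φ (lowerUnip c) = toPGL (lowerUnip (-r * f c)) := by
    intro c
    rw [map_lowerUnip, hw, hu, hr, hneg, mul_neg, neg_mul]
  have hrel := fun {a : F} (ha : a ≠ 0) c => unip_relation hone hne hneg hu hl ha c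
  have hr1 : -r = 1 := by simpa [hone] using hrel one_ne_zero 1
  rw [hr1] at hl hrel
  simp only [one_mul] at hl hrel
  refine ⟨ringHomOfSquares f hadd hone ?_ exists_sq_add_sq, ?_⟩
  · intro a c
    by_cases ha : a = 0
    · have h0 : f 0 = 0 := by simpa using hadd 0 0
      simp [ha, h0]
    · have := hrel ha (c * a ^ 2)
      rwa [mul_div_cancel_right₀ _ (pow_ne_zero 2 ha), eq_div_iff (pow_ne_zero 2 (hne a ha)),
        eq_comm] at this
  · intro h
    refine DFunLike.congr_fun (?_ : φ = (pglMap _).comp toPGL) h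
    refine monoidHom_ext_unip (fun c => ?_) fun c => ?_
    · rw [MonoidHom.comp_apply, pglMap_toPGL, map_upperUnip, hu]; rfl
    · rw [MonoidHom.comp_apply, pglMap_toPGL, map_ring_lowerUnip, hl]; rfl

theorem exists_conj_pglMap_of_map_upperUnip [Finite F] {φ : SL(2, F) →* PGL(2, F)}
    (hker : ∀ c, φ (upperUnip c) = 1 → c = 0)
    (hnc : ¬ Commute (φ (lowerUnip 1)) (φ (upperUnip 1)))
    (h1 : φ (upperUnip 1) = toPGL (upperUnip 1)) :
    ∃ (x : PGL(2, F)) (σ : F →+* F), ∀ h, φ h = x * pglMap σ (toPGL h) * x⁻¹ := by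
  have hex : ∀ c, ∃ d, φ (upperUnip c) = toPGL (upperUnip d) := by
    intro c
    apply exists_eq_upperUnip_of_commute
    rw [← h1]
    change _ * _ = _ * _
    rw [← map_mul, ← map_mul, ← upperUnip_add, ← upperUnip_add, add_comm]
  choose f hf using hex
  have hone : f 1 = 1 := toPGL_upperUnip_injective ((hf 1).symm.trans h1)
  have hne : ∀ c, c ≠ 0 → f c ≠ 0 := by
    intro c hc h
    refine hc (hker c ?_)
    rw [hf, h, upperUnip_zero, map_one]
  obtain ⟨g, hg⟩ := ProjGenLinGroup.mk_surjective (φ (weylElt 1))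
  have hcomm : ∀ a b : F, toPGL (upperUnip a) * toPGL (upperUnip b) =
      toPGL (upperUnip b) * toPGL (upperUnip a) := by
    intro a b
    rw [← map_mul, ← map_mul, ← upperUnip_add, ← upperUnip_add, add_comm]
  -- Otherwise `g` normalizes the upper unipotents, so `φ (lowerUnip 1)` is itself upper unipotent
  -- and commutes with `φ (upperUnip 1)`.
  have hg10 : g 1 0 ≠ 0 := by
    intro h
    apply hnc
    obtain ⟨d, hd⟩ := conj_upperUnip_of_apply_one_zero h (f (-1))
    rw [map_lowerUnip, ← hg, hf, hd, h1]
    exact hcomm _ _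
  -- Chosen so that `g 0 0 + s * g 1 0 = 0`; conjugation by `upperUnip s` leaves the action on upper
  -- unipotents unchanged.
  set s := -(g 0 0 / g 1 0) with hs
  set y : PGL(2, F) := toPGL (upperUnip s) with hy
  obtain ⟨σ, hσ⟩ := exists_ringHom_of_normalized
    (φ := (MulAut.conj y).toMonoidHom.comp φ) (f := f)
    (g := toGL (upperUnip s) * g * toGL (upperUnip (-s)))
    (fun c => by
      change y * φ _ * y⁻¹ = _
      rw [hf, mul_inv_eq_iff_eq_mul]
      exact hcomm _ _) hone hne
    (by
      change y * φ _ * y⁻¹ = _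
      rw [← hg, map_mul, map_mul, mul_inv_eq_iff_eq_mul, mul_assoc]
      have : ProjGenLinGroup.mk (toGL (upperUnip (-s))) * y = 1 := by
        change toPGL _ * toPGL _ = 1
        rw [← map_mul, ← upperUnip_add, neg_add_cancel, upperUnip_zero, map_one]
      rw [this, mul_one]
      rfl)
    (by
      simp only [Units.val_mul, coe_GL_coe_matrix, coe_upperUnip]
      simp only [Matrix.mul_apply, Fin.sum_univ_two]
      simp [hs, hg10])
  refine ⟨y⁻¹, σ, fun h => ?_⟩
  rw [← hσ]
  change _ = y⁻¹ * (y * φ h * y⁻¹) * y⁻¹⁻¹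
  group

/-- A homomorphism from `SL₂(F)` to `PGL₂(F)`, for `F` finite, that is injective on upper
unitriangular matrices and has nonabelian image on the standard ones, is given by a field
endomorphism followed by conjugation. -/
theorem exists_conj_pglMap [Finite F] {φ : SL(2, F) →* PGL(2, F)}
    (hker : ∀ c, φ (upperUnip c) = 1 → c = 0)
    (hnc : ¬ Commute (φ (lowerUnip 1)) (φ (upperUnip 1))) :
    ∃ (x : PGL(2, F)) (σ : F →+* F), ∀ h, φ h = x * pglMap σ (toPGL h) * x⁻¹ := by
  obtain ⟨p, hp⟩ := CharP.exists F
  have : Fact p.Prime := ⟨CharP.char_is_prime F p⟩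
  obtain ⟨y, hy⟩ := exists_conj_eq_upperUnip p (x := φ (upperUnip 1))
    (by rw [← map_pow, upperUnip_pow, CharP.cast_eq_zero, zero_mul, upperUnip_zero, map_one])
    (fun h => one_ne_zero (hker 1 h))
  obtain ⟨x, σ, hσ⟩ := exists_conj_pglMap_of_map_upperUnip
    (φ := (MulAut.conj y⁻¹).toMonoidHom.comp φ)
    (fun c hc => hker c ((MulEquiv.map_eq_one_iff (MulAut.conj y⁻¹)).1 hc))
    (by
      intro h
      exact hnc ((Commute.conj_iff y⁻¹).1 h))
    (by
      change y⁻¹ * φ _ * y⁻¹⁻¹ = _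
      rw [inv_inv, mul_assoc, hy, inv_mul_cancel_left])
  refine ⟨y * x, σ, fun h => ?_⟩
  have := hσ h
  change y⁻¹ * φ h * y⁻¹⁻¹ = _ at this
  calc φ h = y * (y⁻¹ * φ h * y⁻¹⁻¹) * y⁻¹ := by group
    _ = _ := by rw [this]; group

end Hom

/-! ### The actions of `PGL₂ ⋊ Aut F` and their bijectivity. -/

section Automorphisms

variable {F : Type*} [Field F]

open Matrix.SpecialLinearGroup

theorem not_commute_unip :
    ¬ Commute (toPGL (lowerUnip (1 : F))) (toPGL (upperUnip 1)) := by
  intro h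
  obtain ⟨c, hc⟩ := exists_eq_upperUnip_of_commute h
  obtain ⟨l, hl, e⟩ := exists_entries_of_mk_eq hc
  have e1 := e 1 0
  simp at e1
  exact hl e1.symm

/-- Only the trivial element of `PGL₂ ⋊ Aut F` acts trivially on the image of `SL₂`. -/
theorem eq_one_of_conj_pglMap {x : PGL(2, F)} {σ : F →+* F}
    (h : ∀ g : SL(2, F), x * pglMap σ (toPGL g) * x⁻¹ = toPGL g) :
    x = 1 ∧ σ = RingHom.id F := by
  have hu : ∀ c, x * toPGL (upperUnip (σ c)) * x⁻¹ = toPGL (upperUnip c) := fun c => by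
    rw [← map_upperUnip, ← pglMap_toPGL, h]
  have hl : ∀ c, x * toPGL (lowerUnip (σ c)) * x⁻¹ = toPGL (lowerUnip c) := fun c => by
    rw [← map_ring_lowerUnip, ← pglMap_toPGL, h]
  have hx : x = 1 := by
    have h1 := hu 1
    have h2 := hl 1
    rw [map_one, mul_inv_eq_iff_eq_mul] at h1 h2
    obtain ⟨a, ha⟩ := exists_eq_upperUnip_of_commute h1
    obtain ⟨b, hb⟩ := exists_eq_lowerUnip_of_commute h2
    obtain ⟨l, hl, e⟩ := exists_entries_of_mk_eq (ha.symm.trans hb)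
    have e1 := e 1 0
    simp at e1
    rw [hb, e1, lowerUnip_zero, map_one]
  refine ⟨hx, RingHom.ext fun c => ?_⟩
  have := hu c
  rw [hx, one_mul, inv_one, mul_one] at this
  exact toPGL_upperUnip_injective this

/-- The action of `PGL₂(F) ⋊ Aut F` on `PGL₂(F)`. -/
def pglSemiToAut (F : Type*) [Field F] :
    (PGL(2, F) ⋊[fieldAutAction F] RingAut F) →* MulAut PGL(2, F) :=
  SemidirectProduct.lift MulAut.conj (fieldAutAction F) fun σ => by
    ext x y
    simp [MulAut.conj_apply]

theorem pglSemiToAut_apply (y : PGL(2, F) ⋊[fieldAutAction F] RingAut F) (h : PGL(2, F)) :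
    pglSemiToAut F y h = y.left * fieldAutAction F y.right h * y.left⁻¹ := rfl

theorem pglSemiToAut_eq_one {y : PGL(2, F) ⋊[fieldAutAction F] RingAut F}
    (h : ∀ g : SL(2, F), pglSemiToAut F y (toPGL g) = toPGL g) : y = 1 := by
  obtain ⟨h1, h2⟩ := eq_one_of_conj_pglMap (x := y.left) (σ := (y.right : F →+* F)) h
  ext1
  · exact h1
  · exact RingEquiv.ext fun a => RingHom.congr_fun h2 a

/-- Common source of surjectivity for both groups; finiteness makes the field endomorphism
bijective. -/
theorem exists_pglSemiToAut_eq [Finite F] {φ : SL(2, F) →* PGL(2, F)} (hφ : φ.ker = toPGL.ker)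
    (hcomm : ¬ Commute (φ (lowerUnip 1)) (φ (upperUnip 1))) :
    ∃ y : PGL(2, F) ⋊[fieldAutAction F] RingAut F,
      ∀ g, φ g = pglSemiToAut F y (toPGL g) := by
  obtain ⟨x, σ, h⟩ := exists_conj_pglMap (φ := φ) (fun c hc => by
    rw [← MonoidHom.mem_ker, hφ, MonoidHom.mem_ker, ← map_one toPGL, ← upperUnip_zero] at hc
    exact toPGL_upperUnip_injective hc) hcomm
  exact ⟨⟨x, RingEquiv.ofBijective σ (Finite.injective_iff_bijective.1 σ.injective)⟩, h⟩

theorem pglSemiToAut_mem_range (y : PGL(2, F) ⋊[fieldAutAction F] RingAut F)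
    (h : PSL(2, F)) : ∃ h' : PSL(2, F), ProjectiveSpecialLinearGroup.toPGL h' =
      pglSemiToAut F y (ProjectiveSpecialLinearGroup.toPGL h) := by
  induction h using QuotientGroup.induction_on with | H g =>
  obtain ⟨x, hx⟩ := ProjGenLinGroup.mk_surjective y.left
  set g' := SpecialLinearGroup.map (y.right : F →+* F) g
  have hdet : (x * toGL g' * x⁻¹ : Matrix (Fin 2) (Fin 2) F).det = 1 := by
    rw [Matrix.det_mul, Matrix.det_mul, mul_right_comm, ← Matrix.det_mul, ← Units.val_mul,
      mul_inv_cancel]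
    simp
  let k : SL(2, F) := ⟨_, hdet⟩
  refine ⟨QuotientGroup.mk k, ?_⟩
  change ProjGenLinGroup.mk (toGL k) = y.left * pglMap _ (toPGL g) * y.left⁻¹
  rw [pglMap_toPGL, ← hx, ← map_inv]
  change _ = ProjGenLinGroup.mk x * ProjGenLinGroup.mk (toGL g') * ProjGenLinGroup.mk x⁻¹
  rw [← map_mul, ← map_mul]
  congr 1
  ext1
  rfl

/-- The restriction to `PSL₂(F)` of the action of an element of `PGL₂(F) ⋊ Aut F`. -/
noncomputable def pslSemiFun (y : PGL(2, F) ⋊[fieldAutAction F] RingAut F) (h : PSL(2, F)) :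
    PSL(2, F) := (pglSemiToAut_mem_range y h).choose

theorem toPGL_pslSemiFun (y : PGL(2, F) ⋊[fieldAutAction F] RingAut F) (h : PSL(2, F)) :
    ProjectiveSpecialLinearGroup.toPGL (pslSemiFun y h) =
      pglSemiToAut F y (ProjectiveSpecialLinearGroup.toPGL h) :=
  (pglSemiToAut_mem_range y h).choose_spec

theorem pslSemiFun_one (h : PSL(2, F)) : pslSemiFun 1 h = h := by
  apply ProjectiveSpecialLinearGroup.toPGL_injective
  rw [toPGL_pslSemiFun, map_one, MulAut.one_apply]

theorem pslSemiFun_mul (y z : PGL(2, F) ⋊[fieldAutAction F] RingAut F) (h : PSL(2, F)) :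
    pslSemiFun (y * z) h = pslSemiFun y (pslSemiFun z h) := by
  apply ProjectiveSpecialLinearGroup.toPGL_injective
  rw [toPGL_pslSemiFun, toPGL_pslSemiFun, toPGL_pslSemiFun, map_mul, MulAut.mul_apply]

/-- The action of `PGL₂(F) ⋊ Aut F` on `PSL₂(F)`. -/
noncomputable def pslSemiToAut (F : Type*) [Field F] :
    (PGL(2, F) ⋊[fieldAutAction F] RingAut F) →* MulAut PSL(2, F) where
  toFun y :=
    { toFun := pslSemiFun y
      invFun := pslSemiFun y⁻¹
      left_inv := fun h => by rw [← pslSemiFun_mul, inv_mul_cancel, pslSemiFun_one]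
      right_inv := fun h => by rw [← pslSemiFun_mul, mul_inv_cancel, pslSemiFun_one]
      map_mul' := fun a b => by
        apply ProjectiveSpecialLinearGroup.toPGL_injective
        simp only [toPGL_pslSemiFun, map_mul] }
  map_one' := MulEquiv.ext pslSemiFun_one
  map_mul' y z := MulEquiv.ext (pslSemiFun_mul y z)

theorem toPGL_pslSemiToAut (y : PGL(2, F) ⋊[fieldAutAction F] RingAut F) (h : PSL(2, F)) :
    ProjectiveSpecialLinearGroup.toPGL (pslSemiToAut F y h) =
      pglSemiToAut F y (ProjectiveSpecialLinearGroup.toPGL h) :=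
  toPGL_pslSemiFun y h

theorem pglSemiToAut_bijective [Finite F] : Function.Bijective (pglSemiToAut F) := by
  refine ⟨(injective_iff_map_eq_one _).2 fun y hy => pglSemiToAut_eq_one fun g => by rw [hy]; rfl,
    fun β => ?_⟩
  obtain ⟨y, hy⟩ := exists_pglSemiToAut_eq (φ := β.toMonoidHom.comp toPGL)
    (by ext g; simp [MonoidHom.mem_ker])
    (fun h => not_commute_unip ((commute_map_iff β.injective).1 h))
  refine ⟨y, ?_⟩
  set γ : MulAut PGL(2, F) := (pglSemiToAut F y)⁻¹ * β with hγ
  have hfix : ∀ g : SL(2, F), γ (toPGL g) = toPGL g := fun g => by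
    rw [hγ, MulAut.mul_apply, show β (toPGL g) = _ from hy g, MulAut.inv_apply_self]
  suffices γ = 1 from (inv_mul_eq_one.1 this)
  ext1 x
  rw [MulAut.one_apply, eq_comm, ← inv_mul_eq_one]
  -- `γ` fixes both `toPGL g` and its conjugate by `x`, so `x` and `γ x` conjugate `toPGL g` alike
  -- and `x⁻¹ * γ x` centralizes the image of `SL₂`.
  have key : (SemidirectProduct.inl (x⁻¹ * γ x) : PGL(2, F) ⋊[fieldAutAction F] RingAut F) = 1 := by
    refine pglSemiToAut_eq_one fun g => ?_
    obtain ⟨h', hh⟩ := pglSemiToAut_mem_range (SemidirectProduct.inl x) (QuotientGroup.mk g)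
    induction h' using QuotientGroup.induction_on with | H g' =>
    have e1 : toPGL g' = x * toPGL g * x⁻¹ := by
      simpa [pglSemiToAut_apply] using hh
    have e2 : γ x * toPGL g * (γ x)⁻¹ = x * toPGL g * x⁻¹ := by
      have := hfix g'
      rw [e1, map_mul, map_mul, map_inv, hfix] at this
      exact this
    rw [pglSemiToAut_apply]
    simp only [SemidirectProduct.left_inl, SemidirectProduct.right_inl, map_one, MulAut.one_apply]
    calc x⁻¹ * γ x * toPGL g * (x⁻¹ * γ x)⁻¹ = x⁻¹ * (γ x * toPGL g * (γ x)⁻¹) * x := by group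
      _ = _ := by rw [e2]; group
  simpa using congrArg SemidirectProduct.left key

theorem pslSemiToAut_bijective [Finite F] : Function.Bijective (pslSemiToAut F) := by
  refine ⟨(injective_iff_map_eq_one _).2 fun y hy => pglSemiToAut_eq_one fun g => ?_, fun α => ?_⟩
  · have := toPGL_pslSemiToAut y (QuotientGroup.mk g)
    rw [hy] at this
    exact this.symm
  · obtain ⟨y, hy⟩ := exists_pglSemiToAut_eq
      (φ := (ProjectiveSpecialLinearGroup.toPGL.comp α.toMonoidHom).comp (QuotientGroup.mk' _))
      (by
        rw [SpecialLinearGroup.toPGL_ker]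
        ext g
        rw [MonoidHom.mem_ker, MonoidHom.comp_apply, MonoidHom.comp_apply,
          map_eq_one_iff _ ProjectiveSpecialLinearGroup.toPGL_injective]
        change α _ = 1 ↔ _
        rw [MulEquiv.map_eq_one_iff]
        exact QuotientGroup.eq_one_iff g)
      (fun h => not_commute_unip (by
        have h1 := (commute_map_iff (ProjectiveSpecialLinearGroup.toPGL_injective)).1 h
        have h2 := (commute_map_iff α.injective).1 h1
        exact h2.map ProjectiveSpecialLinearGroup.toPGL))
    refine ⟨y, MulEquiv.ext fun h => ProjectiveSpecialLinearGroup.toPGL_injective ?_⟩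
    rw [toPGL_pslSemiToAut]
    induction h using QuotientGroup.induction_on with | H g =>
    exact (hy g).symm

end Automorphisms

/-! ### Automorphisms of a finite field. -/

section FieldAut

/-- Every ring automorphism fixes the prime field, so `RingAut F` is the Galois group over `ZMod p`,
generated by Frobenius, whose order is the degree. -/
theorem exists_frobenius_generator (p : ℕ) [Fact p.Prime] (F : Type*) [Field F] [Finite F]
    [CharP F p] : ∃ φ : RingAut F, (∀ a : F, φ a = a ^ p) ∧ Subgroup.zpowers φ = ⊤ ∧
      p ^ orderOf φ = Nat.card F := by
  let _ : Algebra (ZMod p) F := ZMod.algebra F p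
  set ψ := FiniteField.frobeniusAlgEquivOfAlgebraic (ZMod p) F
  have hψ : ∀ a, ψ a = a ^ p := fun a => by simp [ψ, ZMod.card]
  let ι : (F ≃ₐ[ZMod p] F) →* RingAut F :=
    { toFun := fun e => e.toRingEquiv
      map_one' := rfl
      map_mul' := fun _ _ => rfl }
  have hι : Function.Injective ι := fun a b h => AlgEquiv.ext fun x => RingEquiv.congr_fun h x
  refine ⟨ι ψ, hψ, ?_, ?_⟩
  · rw [eq_top_iff]
    intro σ _
    let σ' : F ≃ₐ[ZMod p] F := AlgEquiv.ofRingEquiv (f := σ) fun r => by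
      have : (σ : F →+* F).comp (algebraMap (ZMod p) F) = algebraMap (ZMod p) F :=
        RingHom.ext_zmod _ _
      exact RingHom.congr_fun this r
    obtain ⟨n, hn⟩ := (FiniteField.bijective_frobeniusAlgEquivOfAlgebraic_pow (ZMod p) F).2 σ'
    refine ⟨n, ?_⟩
    have : ι (ψ ^ (n : ℕ)) = σ := by
      rw [show ψ ^ (n : ℕ) = σ' from hn]
      rfl
    rw [← this, map_pow]
    simp
  · rw [orderOf_injective ι hι, FiniteField.orderOf_frobeniusAlgEquivOfAlgebraic,
      Module.natCard_eq_pow_finrank (K := ZMod p) (V := F), Nat.card_zmod]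

end FieldAut
/-- `F` is any field with `p ^ k` elements; the group `T` of the semidirect product is the group
`RingAut F` of all automorphisms of `F`, acting on `PGL₂(F)` through matrix entries. -/
theorem proposition4p4 (p k : ℕ) (hp : p.Prime) (hk : 1 ≤ k)
    (F : Type*) [Field F] [Finite F] (hF : Nat.card F = p ^ k) :
    -- `T` is cyclic of order `k`, generated by the Frobenius automorphism
    (∃ φ : RingAut F, (∀ a : F, φ a = a ^ p) ∧ Subgroup.zpowers φ = ⊤) ∧
    Nonempty (RingAut F ≃* Multiplicative (ZMod k)) ∧
    ∃ (eS : (Matrix.ProjGenLinGroup (Fin 2) F ⋊[fieldAutAction F] RingAut F) ≃*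
          MulAut (Matrix.ProjectiveSpecialLinearGroup (Fin 2) F))
      (eG : (Matrix.ProjGenLinGroup (Fin 2) F ⋊[fieldAutAction F] RingAut F) ≃*
          MulAut (Matrix.ProjGenLinGroup (Fin 2) F))
      (e : MulAut (Matrix.ProjectiveSpecialLinearGroup (Fin 2) F) ≃*
          MulAut (Matrix.ProjGenLinGroup (Fin 2) F)),
      -- `(g, σ)` acts on `PSL₂(F) ⊆ PGL₂(F)` by `h ↦ g * σ(h) * g⁻¹`
      (∀ (g : Matrix.ProjGenLinGroup (Fin 2) F) (σ : RingAut F)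
          (h : Matrix.ProjectiveSpecialLinearGroup (Fin 2) F),
        Matrix.ProjectiveSpecialLinearGroup.toPGL (eS ⟨g, σ⟩ h) =
          g * fieldAutAction F σ (Matrix.ProjectiveSpecialLinearGroup.toPGL h) * g⁻¹) ∧
      -- `(g, σ)` acts on `PGL₂(F)` by `h ↦ g * σ(h) * g⁻¹`
      (∀ (g : Matrix.ProjGenLinGroup (Fin 2) F) (σ : RingAut F)
          (h : Matrix.ProjGenLinGroup (Fin 2) F),
        eG ⟨g, σ⟩ h = g * fieldAutAction F σ h * g⁻¹) ∧
      -- every automorphism of `PSL₂(F)` corresponds to its extension to `PGL₂(F)`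
      (∀ (α : MulAut (Matrix.ProjectiveSpecialLinearGroup (Fin 2) F))
          (h : Matrix.ProjectiveSpecialLinearGroup (Fin 2) F),
        e α (Matrix.ProjectiveSpecialLinearGroup.toPGL h) =
          Matrix.ProjectiveSpecialLinearGroup.toPGL (α h)) := by

  have : Fact p.Prime := ⟨hp⟩
  have hc : CharP F p := by
    obtain ⟨q, hq⟩ := CharP.exists F
    have hqp : Fact q.Prime := ⟨CharP.char_is_prime F q⟩
    have := Fintype.ofFinite F
    obtain ⟨n, hq', hn⟩ := FiniteField.card F q
    rw [← Nat.card_eq_fintype_card, hF] at hn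
    have : p = q := (Nat.prime_dvd_prime_iff_eq hp hq').1
      (hp.dvd_of_dvd_pow (hn ▸ dvd_pow_self p (by lia)))
    exact this ▸ hq
  obtain ⟨φ, hφ, hgen, hord⟩ := exists_frobenius_generator p F
  have hk' : orderOf φ = k := Nat.pow_right_injective hp.two_le (hord.trans hF)
  refine ⟨⟨φ, hφ, hgen⟩, ?_, ?_⟩
  · have hcyc : IsCyclic (RingAut F) := ⟨φ, fun x => Subgroup.mem_zpowers_iff.1 (hgen ▸ Subgroup.mem_top x)⟩
    have hcard : Nat.card (RingAut F) = k := by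
      rw [← hk', ← Nat.card_zpowers, hgen, Subgroup.card_top]
    have e := zmodCyclicMulEquiv hcyc
    rw [hcard] at e
    exact ⟨e.symm⟩
  · let eS := MulEquiv.ofBijective (pslSemiToAut F) pslSemiToAut_bijective
    let eG := MulEquiv.ofBijective (pglSemiToAut F) pglSemiToAut_bijective
    refine ⟨eS, eG, eS.symm.trans eG, fun g σ h => toPGL_pslSemiToAut ⟨g, σ⟩ h,
      fun g σ h => rfl, fun α h => ?_⟩
    obtain ⟨y, rfl⟩ := eS.surjective α
    rw [MulEquiv.trans_apply, MulEquiv.symm_apply_apply]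
    exact (toPGL_pslSemiToAut y h).symm
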